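/- For every security parameter $\kappa\in\mathbb N$ let $\mathbb F=\mathbb F_\kappa$ be a finite field with $|\mathbb F|\ge 2^\kappa$, let $K,T>0$ and $N\ge K+T$ be integers (all of which may depend on $\kappa$), let $\alpha_1,\dots,\alpha_N\in\mathbb F$ be distinct, and fix an injective encoding of field elements as bit strings of some fixed length. Let $\mathsf H:\{0,1\}^*\to\{0,1\}^\kappa$ be a random oracle. *Hiding erasure-correcting code.* For $\mathbf m\in\mathbb F^K$ and $\mathbf s\in\mathbb F^T$ let $f(X)=\sum_{k=1}^K m_kX^{k-1}+\sum_{j=1}^T s_jX^{K-1+j}$ and $\mathsf{Enc}(\mathbf m,\mathbf s)=(f(\alpha_1),\dots,f(\alpha_N))\in\mathbb F^N$. *Salted Merkle tree.* Let $d$ be least with $N\le 2^d$; pad vectors in $\mathbb F^N$ with zeros to length $2^d$. Take the complete binary tree of depth $d$. Its $i$-th leaf is identified by the $d$-bit binary representation $\mathrm{leaf}(i)$ of $i-1$, and the node $b\in\{0,1,*\}^d$ that is $n\geq 1$ levels above the leaves is identified by the common first $d-n$ bits of the leaves below it followed by $n$ stars; identifiers are written as bit strings with two bits per symbol. For $\mathbf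 v,\mathbf r\in\mathbb F^N$ put $h_{\mathrm{leaf}(i)}=\mathsf H(\mathrm{leaf}(i)\,\|\,v_i\,\|\,r_i)$ at the leaves and $h_b=\mathsf H(b\,\|\,h_{b_{\mathrm L}}\,\|\,h_{b_{\mathrm R}})$ at every interior node $b$ with children $b_{\mathrm L},b_{\mathrm R}$. The commitment $\mathsf{Commit}(\mathbf v,\mathbf r)$ is the hash at the root, and the witness $\mathsf{Open}(\mathbf v,\mathbf r,i)$ is the list of the hashes at the siblings of the nodes on the path from leaf $i$ to the root. *Game.* A probabilistic adversary $\mathcal A$, which may query $\mathsf H$ at any time, provides $\mathbf v^{(0)},\mathbf v^{(1)}\in\mathbb F^N$. The challenger flips an unbiased coin $b\in\{0,1\}$, samples $\mathbf m'\in\mathbb F^K$ and $\mathbf r'\in\mathbb F^T$ uniformly at random (all independently of each other, of $\mathsf H$ and of the coins of $\mathcal A$), computes $\mathbf r=\mathsf{Enc}(\mathbf m',\mathbf r')$, and gives $C=\mathsf{Commit}(\mathbf v^{(b)},\mathbf r)$ to $\mathcal A$. Then $\mathcal A$ may adaptively make up to $T$ opening queries at distinct indices $i$ with $v^{(0)}_i=v^{(1)}_i$,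 and receives $r_i$ and $\mathsf{Open}(\mathbf v^{(b)},\mathbf r,i)$ for each (any other opening query is refused). Finally $\mathcal A$ outputs a guess $\hat b\in\{0,1\}$, and succeeds iff $\hat b=b$. *Claim.* For every PPT adversary $\mathcal A$, and more generally for every (possibly non-uniform and computationally unbounded) adversary for which there is a polynomial $p$ such that $\mathcal A$ makes at most $p(\kappa)$ queries to $\mathsf H$, the advantage $\bigl|\Pr[\hat b=b]-\tfrac12\bigr|$ is negligible in $\kappa$: for every $c>0$ there is an $n_0$ such that it is less than $1/\kappa^c$ for all $\kappa\ge n_0$. -/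

import Mathlib

open MeasureTheory

/-! ### Negligible functions, uniform sampling, the random oracle -/

/-- A function `f` is negligible if for every `c > 0`, eventually `f n < 1 / n ^ c`. -/
def Negligible (f : ℕ → ℝ) : Prop :=
  ∀ c : ℝ, 0 < c → ∃ n₀ : ℕ, ∀ n : ℕ, n₀ ≤ n → f n < 1 / (n : ℝ) ^ c

/-- The uniform distribution on a nonempty finite type. -/
noncomputable def uniformMeasure (α : Type*) [Fintype α] [Nonempty α] [MeasurableSpace α] :
    Measure α :=
  (PMF.uniformOfFintype α).toMeasure

/-- Hash values: bit strings of length `κ`. -/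
abbrev Digest (κ : ℕ) : Type := Fin κ → Bool

/-- Functions from all finite bit strings to bit strings of length `κ`. -/
abbrev Oracle (κ : ℕ) : Type := List Bool → Digest κ

/-- The law of the random oracle: the values at distinct bit strings are independent and uniform. -/
noncomputable def randomOracle (κ : ℕ) : Measure (Oracle κ) :=
  Measure.infinitePi fun _ : List Bool => uniformMeasure (Digest κ)

/-- The law of an infinite sequence of independent unbiased coin tosses. -/
noncomputable def coinTosses : Measure (ℕ → Bool) :=
  Measure.infinitePi fun _ : ℕ => uniformMeasure Bool

/-! ### Reed-Solomon hiding erasure-correcting code -/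

/-- The polynomial `∑ₖ mₖ Xᵏ + ∑ⱼ rⱼ X ^ (K + j)`, with `k` and `j` counted from `0`: its
coefficients are the message followed by the randomness. -/
noncomputable def heccPolynomial {F : Type*} [Field F] {K T : ℕ}
    (m : Fin K → F) (r : Fin T → F) : Polynomial F :=
  (∑ k : Fin K, Polynomial.C (m k) * Polynomial.X ^ (k : ℕ)) +
    ∑ j : Fin T, Polynomial.C (r j) * Polynomial.X ^ (K + (j : ℕ))

/-- The encoding: shred `i` is the value of the polynomial at the evaluation point `α i`. -/
noncomputable def heccEncode {F : Type*} [Field F] {N K T : ℕ} (α : Fin N → F)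
    (m : Fin K → F) (r : Fin T → F) : Fin N → F :=
  fun i => (heccPolynomial m r).eval (α i)

/-! ### Salted Merkle tree

Indices are counted from `0`. The node of height `n` and position `j` in the complete binary tree
of depth `d` (leaves have height `0`, the root has height `d`) has the children of height `n - 1`
at the positions `2 * j` and `2 * j + 1`. -/

/-- The identifier in `{0, 1, *}ᵈ` of the node of height `n` and position `j`: the `d - n` binary
digits of `j`, most significant first, followed by `n` stars. The star is `none`. -/
def nodeLabel (d n j : ℕ) : List (Option Bool) :=
  (List.range (d - n)).map (fun t => some (j.testBit (d - n - 1 - t))) ++ List.replicate n none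

/-- The symbols `0`, `1`, `*` as the bit pairs `00`, `01`, `10`. -/
def symbolBits : Option Bool → List Bool
  | some b => [false, b]
  | none => [true, false]

/-- The identifier of a node as a bit string of length `2 * d`. -/
def labelBits (d n j : ℕ) : List Bool :=
  (nodeLabel d n j).flatMap symbolBits

/-- Extension by zero of a vector, used for padding to a length that is a power of two. -/
def padded {F : Type*} [Zero F] {L : ℕ} (x : Fin L → F) (j : ℕ) : F :=
  if h : j < L then x ⟨j, h⟩ else 0

/-- The depth of the tree for vectors of length `L`: the least `d` with `L ≤ 2 ^ d`. -/
def treeDepth (L : ℕ) : ℕ := Nat.clog 2 L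

/-- The hash at the leaf `j`, namely `H (leaf j ‖ v j ‖ r j)`, where `enc` represents field
elements as bit strings of a fixed length. -/
def leafHash {κ ℓ L : ℕ} {F : Type*} [Zero F] (H : Oracle κ) (enc : F → Fin ℓ → Bool)
    (v r : Fin L → F) (j : ℕ) : Digest κ :=
  H (labelBits (treeDepth L) 0 j ++ List.ofFn (enc (padded v j)) ++ List.ofFn (enc (padded r j)))

/-- The hash at the node of height `n` and position `j`; at an interior node `b` with the children
`b_L` and `b_R` it is `H (b ‖ h b_L ‖ h b_R)`. -/
def nodeHash {κ ℓ L : ℕ} {F : Type*} [Zero F] (H : Oracle κ) (enc : F → Fin ℓ → Bool)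
    (v r : Fin L → F) : ℕ → ℕ → Digest κ
  | 0, j => leafHash H enc v r j
  | n + 1, j =>
      H (labelBits (treeDepth L) (n + 1) j ++
        List.ofFn (nodeHash H enc v r n (2 * j)) ++
        List.ofFn (nodeHash H enc v r n (2 * j + 1)))

/-- The commitment to `v` with randomness `r`: the hash at the root. -/
def merkleCommit {κ ℓ L : ℕ} {F : Type*} [Zero F] (H : Oracle κ) (enc : F → Fin ℓ → Bool)
    (v r : Fin L → F) : Digest κ :=
  nodeHash H enc v r (treeDepth L) 0

/-- Merkle paths: one hash for each height below the root. -/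
abbrev Witness (κ L : ℕ) : Type := Fin (treeDepth L) → Digest κ

/-- The witness for the position `i`: the hashes at the siblings of the nodes on the path from the
leaf `i` to the root. The node of height `n` on that path has position `i / 2 ^ n`, and the
position of its sibling differs from this in the last bit. -/
def merkleOpen {κ ℓ L : ℕ} {F : Type*} [Zero F] (H : Oracle κ) (enc : F → Fin ℓ → Bool)
    (v r : Fin L → F) (i : Fin L) : Witness κ L :=
  fun n => nodeHash H enc v r n (((i : ℕ) / 2 ^ (n : ℕ)) ^^^ 1)

/-! ### Adversaries

An adversary is an arbitrary adaptive strategy. The actions it can take are: tossing a coin,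
querying the random oracle, interacting with the challenger, and giving its output; the next action
depends in an arbitrary way on all that it has seen. No bound is put on what it computes between
two actions, and there may be a different strategy for every `κ`. -/

/-- What an adversary does after it has received the commitment. -/
inductive Guesser (κ : ℕ) (F : Type*) (N : ℕ)
  /-- output the guess `b` -/
  | guess (b : Bool)
  /-- toss a coin -/
  | toss (next : Bool → Guesser κ F N)
  /-- query the random oracle at `x` -/
  | hash (x : List Bool) (next : Digest κ → Guesser κ F N)
  /-- ask for the opening at position `i`; the reply `none` is a refusal -/
  | openAt (i : Fin N) (next : Option (F × Witness κ N) → Guesser κ F N)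

/-- What an adversary does from the beginning. -/
inductive Adversary (κ : ℕ) (F : Type*) (N : ℕ)
  /-- provide the two challenge vectors, and continue when given the commitment -/
  | challenge (v₀ v₁ : Fin N → F) (next : Digest κ → Guesser κ F N)
  /-- toss a coin -/
  | toss (next : Bool → Adversary κ F N)
  /-- query the random oracle at `x` -/
  | hash (x : List Bool) (next : Digest κ → Adversary κ F N)

/-- On every branch, at most `q` queries to the random oracle are made. -/
def Guesser.QueriesAtMost {κ : ℕ} {F : Type*} {N : ℕ} : Guesser κ F N → ℕ → Prop
  | .guess _, _ => True
  | .toss next, q => ∀ c, (next c).QueriesAtMost q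
  | .hash _ next, q => 0 < q ∧ ∀ y, (next y).QueriesAtMost (q - 1)
  | .openAt _ next, q => ∀ a, (next a).QueriesAtMost q

/-- On every branch, at most `q` queries to the random oracle are made in total. -/
def Adversary.QueriesAtMost {κ : ℕ} {F : Type*} {N : ℕ} : Adversary κ F N → ℕ → Prop
  | .challenge _ _ next, q => ∀ C, (next C).QueriesAtMost q
  | .toss next, q => ∀ c, (next c).QueriesAtMost q
  | .hash _ next, q => 0 < q ∧ ∀ y, (next y).QueriesAtMost (q - 1)

/-! ### The hiding game -/

open Classical in
/-- The guess made after the commitment has been received, when `v` with randomness `r` has been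
committed to and the coins still to be tossed are `coins`. The set `Q` holds the positions opened
so far. The position `i` is opened only if the challenge vectors agree there, `i` has not been
opened before, and fewer than `T` positions have been opened. -/
noncomputable def Guesser.run {κ ℓ N : ℕ} {F : Type*} [Zero F] (H : Oracle κ)
    (enc : F → Fin ℓ → Bool) (T : ℕ) (v₀ v₁ v r : Fin N → F) :
    Guesser κ F N → (coins : ℕ → Bool) → (Q : Finset (Fin N)) → Bool
  | .guess b, _, _ => b
  | .toss next, coins, Q =>
      (next (coins 0)).run H enc T v₀ v₁ v r (fun n => coins (n + 1)) Q
  | .hash x next, coins, Q => (next (H x)).run H enc T v₀ v₁ v r coins Q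
  | .openAt i next, coins, Q =>
      if v₀ i = v₁ i ∧ i ∉ Q ∧ Q.card < T then
        (next (some (r i, merkleOpen H enc v r i))).run H enc T v₀ v₁ v r coins (insert i Q)
      else
        (next none).run H enc T v₀ v₁ v r coins Q

/-- The guess that the adversary makes in the game with oracle `H`, challenge bit `b` (`false`
selects the first challenge vector), commitment randomness `r` and coins `coins`. -/
noncomputable def Adversary.run {κ ℓ N : ℕ} {F : Type*} [Zero F] (H : Oracle κ)
    (enc : F → Fin ℓ → Bool) (T : ℕ) (b : Bool) (r : Fin N → F) :
    Adversary κ F N → (coins : ℕ → Bool) → Bool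
  | .challenge v₀ v₁ next, coins =>
      (next (merkleCommit H enc (if b then v₁ else v₀) r)).run H enc T v₀ v₁
        (if b then v₁ else v₀) r coins ∅
  | .toss next, coins => (next (coins 0)).run H enc T b r (fun n => coins (n + 1))
  | .hash x next, coins => (next (H x)).run H enc T b r coins

/-- The probability that the adversary guesses the challenge bit. The oracle `H`, the coins of the
adversary, the challenge bit `b`, the message `m ∈ Fᴷ` and the randomness `s ∈ Fᵀ` are independent
and uniform, and the commitment randomness is the encoding of `m` with randomness `s`. -/
noncomputable def successProbability {κ ℓ N : ℕ} {F : Type*} [Field F] [Fintype F] (K T : ℕ)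
    (α : Fin N → F) (enc : F → Fin ℓ → Bool) (A : Adversary κ F N) : ℝ :=
  letI : MeasurableSpace F := ⊤
  ((randomOracle κ).prod (coinTosses.prod ((uniformMeasure Bool).prod
      ((uniformMeasure (Fin K → F)).prod (uniformMeasure (Fin T → F)))))).real
    {ω : Oracle κ × (ℕ → Bool) × Bool × (Fin K → F) × (Fin T → F) |
      A.run ω.1 enc T ω.2.2.1 (heccEncode α ω.2.2.2.1 ω.2.2.2.2) ω.2.1 = ω.2.2.1}

/-! ### Node identifiers -/

/-! Hiding rests on the salts alone: as long as no query contains the salt of an unopened leaf, the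
leaf hashes are fresh random strings unrelated to the committed vector. Collision resistance plays
no role, and `q` queries give an advantage of at most `q / (2 * |F|)`.

Let `z i` be distinct strings longer than every query of the adversary and every input hashed in the
tree. In the ideal game leaf `i` has the hash `H (z i)`, so its outcome does not involve the
challenge bit; it aborts when a query contains the salt of an unopened leaf. Swapping the true leaf
inputs with the `z i` is an involution `σ` of the bit strings, so for a fixed vector `H ∘ σ` has the
same law as `H`. Without an abort, the real game on `H ∘ σ` ends with the guess of the ideal game on
`H` (`Adversary.run_reprogram`). Since the committed vector may depend on `H`, the event is split
according to it, which gives `P(ideal = x) ≤ P(real = x)` for each guess `x`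
(`randomOracle_idealRun_le_run`).

A query names at most one leaf and one salt. The salts are values of a random polynomial of degree
below `K + T`, and `K > 0`, so `T` of them leave any other one uniform (`saltsHidden_heccEncode`). A
union bound then gives abort probability at most `q / |F|`. As the ideal guess is independent of the
bit, it is right, and likewise wrong, with probability at least `(1 - q / |F|) / 2`. Both bounds
pass to the real game and enclose the success probability. -/

theorem flatMap_symbolBits_injective :
    Function.Injective (fun l : List (Option Bool) => l.flatMap symbolBits) := by
  intro l
  induction l with
  | nil =>
    intro l' h
    cases l' with
    | nil => rfl
    | cons a t => rcases a with _ | b <;> simp [symbolBits] at h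
  | cons a t ih =>
    intro l' h
    cases l' with
    | nil => rcases a with _ | b <;> simp [symbolBits] at h
    | cons a' t' =>
      simp only [List.flatMap_cons] at h
      have hl : ∀ s : Option Bool, (symbolBits s).length = 2 := by rintro (_ | b) <;> rfl
      obtain ⟨h1, h2⟩ := List.append_inj h (by rw [hl, hl])
      have h3 : a = a' := by
        rcases a with _ | b <;> rcases a' with _ | b' <;> simp_all [symbolBits]
      rw [h3, ih h2]

theorem labelBits_length {d n : ℕ} (hn : n ≤ d) (j : ℕ) : (labelBits d n j).length = 2 * d := by
  have hl : ∀ l : List (Option Bool), (l.flatMap symbolBits).length = 2 * l.length := by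
    intro l
    induction l with
    | nil => rfl
    | cons a t ih =>
      rw [List.flatMap_cons, List.length_append, ih]
      rcases a with _ | b <;> simp [symbolBits] <;> ring
  rw [labelBits, hl]
  simp only [nodeLabel, List.length_append, List.length_map, List.length_range,
    List.length_replicate]
  omega

theorem labelBits_leaf_inj {d i j : ℕ} (hi : i < 2 ^ d) (hj : j < 2 ^ d)
    (h : labelBits d 0 i = labelBits d 0 j) : i = j := by
  have h1 := flatMap_symbolBits_injective h
  simp only [nodeLabel, List.replicate_zero, List.append_nil, Nat.sub_zero] at h1
  refine Nat.eq_of_testBit_eq fun t => ?_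
  by_cases ht : t < d
  · have h2 := List.map_inj_left.1 h1 (d - 1 - t) (List.mem_range.2 (by omega))
    have h3 : d - 1 - (d - 1 - t) = t := by omega
    simpa [h3] using h2
  · have h4 : 2 ^ d ≤ 2 ^ t := Nat.pow_le_pow_right (by norm_num) (by omega)
    rw [Nat.testBit_lt_two_pow (lt_of_lt_of_le hi h4), Nat.testBit_lt_two_pow (lt_of_lt_of_le hj h4)]

/-- Only interior identifiers contain a star. This separates the oracle inputs at interior nodes
from those at leaves. -/
theorem labelBits_succ_ne_leaf (d n i j : ℕ) : labelBits d (n + 1) j ≠ labelBits d 0 i := by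
  intro h
  have h1 := flatMap_symbolBits_injective h
  have h2 : (none : Option Bool) ∈ nodeLabel d (n + 1) j := by simp [nodeLabel]
  rw [h1] at h2
  simp [nodeLabel] at h2

/-! ### Inputs of the oracle at the leaves -/

/-- The input that is hashed at the leaf `j` with value `a` and salt `g`. -/
def leafInput {ℓ : ℕ} {F : Type*} (L : ℕ) (enc : F → Fin ℓ → Bool) (j : ℕ) (a g : F) : List Bool :=
  labelBits (treeDepth L) 0 j ++ List.ofFn (enc a) ++ List.ofFn (enc g)

theorem leafInput_length {ℓ : ℕ} {F : Type*} (L : ℕ) (enc : F → Fin ℓ → Bool) (j : ℕ) (a g : F) :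
    (leafInput L enc j a g).length = 2 * treeDepth L + 2 * ℓ := by
  simp [leafInput, labelBits_length]; ring

/-- All three fields have fixed lengths, so the input can be parsed uniquely; in particular a query
determines the leaf and the salt it tests. -/
theorem leafInput_inj {ℓ L : ℕ} {F : Type*} {enc : F → Fin ℓ → Bool}
    (henc : Function.Injective enc) {i j : ℕ} {a a' g g' : F} (hi : i < 2 ^ treeDepth L)
    (hj : j < 2 ^ treeDepth L) (h : leafInput L enc i a g = leafInput L enc j a' g') :
    i = j ∧ a = a' ∧ g = g' := by
  unfold leafInput at h
  obtain ⟨h1, h2⟩ := List.append_inj h (by simp [labelBits_length])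
  obtain ⟨h3, h4⟩ := List.append_inj h1 (by simp [labelBits_length])
  exact ⟨labelBits_leaf_inj hi hj h3, henc (List.ofFn_injective h4), henc (List.ofFn_injective h2)⟩

theorem lt_two_pow_treeDepth {N : ℕ} (i : Fin N) : (i : ℕ) < 2 ^ treeDepth N :=
  i.2.trans_le (Nat.le_pow_clog (by norm_num) N)

/-! ### Exchanging two families of points -/

section Exchange

variable {ι X : Type*}

open Classical in
/-- The map that exchanges `p i` and `z i` for every `i`. -/
noncomputable def exchangeFun (p z : ι → X) (x : X) : X :=
  if h : ∃ i, p i = x then z h.choose else if h : ∃ i, z i = x then p h.choose else x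

theorem exchangeFun_left {p : ι → X} (z : ι → X) (hp : Function.Injective p) (i : ι) :
    exchangeFun p z (p i) = z i := by
  have h : ∃ j, p j = p i := ⟨i, rfl⟩
  rw [exchangeFun, dif_pos h, hp h.choose_spec]

theorem exchangeFun_right {p z : ι → X} (hz : Function.Injective z) (hpz : ∀ i j, p i ≠ z j)
    (i : ι) : exchangeFun p z (z i) = p i := by
  have h : ∃ j, z j = z i := ⟨i, rfl⟩
  rw [exchangeFun, dif_neg (by rintro ⟨j, hj⟩; exact hpz _ _ hj), dif_pos h, hz h.choose_spec]

theorem exchangeFun_of_ne {p z : ι → X} {x : X} (hp : ∀ i, p i ≠ x) (hz : ∀ i, z i ≠ x) :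
    exchangeFun p z x = x := by
  rw [exchangeFun, dif_neg (by simpa using hp), dif_neg (by simpa using hz)]

theorem exchangeFun_involutive {p z : ι → X} (hp : Function.Injective p)
    (hz : Function.Injective z) (hpz : ∀ i j, p i ≠ z j) :
    Function.Involutive (exchangeFun p z) := by
  intro x
  by_cases h : ∃ i, p i = x
  · obtain ⟨i, rfl⟩ := h
    rw [exchangeFun_left z hp, exchangeFun_right hz hpz]
  by_cases h' : ∃ i, z i = x
  · obtain ⟨i, rfl⟩ := h'
    rw [exchangeFun_right hz hpz, exchangeFun_left z hp]
  · push Not at h h'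
    rw [exchangeFun_of_ne h h', exchangeFun_of_ne h h']

end Exchange

/-! ### Uniform measures -/

instance (α : Type*) [Fintype α] [Nonempty α] [MeasurableSpace α] :
    IsProbabilityMeasure (uniformMeasure α) := by
  unfold uniformMeasure; infer_instance

instance (κ : ℕ) : IsProbabilityMeasure (randomOracle κ) := by
  unfold randomOracle; infer_instance

instance : IsProbabilityMeasure coinTosses := by
  unfold coinTosses; infer_instance

/-- A product of copies of one measure is invariant under permuting the coordinates. -/
theorem measurePreserving_comp_perm {ι X : Type*} [MeasurableSpace X] (μ : Measure X)
    [IsProbabilityMeasure μ] (e : Equiv.Perm ι) :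
    MeasurePreserving (fun f : ι → X => f ∘ e) (Measure.infinitePi fun _ => μ)
      (Measure.infinitePi fun _ => μ) := by
  refine ⟨by fun_prop, ?_⟩
  have h := Measure.infinitePi_map_piCongrLeft (μ := fun _ : ι => μ) e.symm
  rw [← h]
  congr 1
  ext f i
  obtain ⟨j, rfl⟩ := e.symm.surjective i
  rw [MeasurableEquiv.coe_piCongrLeft, Equiv.piCongrLeft_apply_apply, Function.comp_apply,
    Equiv.apply_symm_apply]

theorem measurePreserving_randomOracle_comp (κ : ℕ) {f : List Bool → List Bool}
    (hf : Function.Involutive f) :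
    MeasurePreserving (fun H : Oracle κ => H ∘ f) (randomOracle κ) (randomOracle κ) :=
  measurePreserving_comp_perm _ hf.toPerm

theorem uniformMeasure_apply {α : Type*} [Fintype α] [Nonempty α] [MeasurableSpace α]
    [MeasurableSingletonClass α] (s : Set α) [DecidablePred (· ∈ s)] :
    uniformMeasure α s = (Finset.univ.filter (· ∈ s)).card / (Fintype.card α : ENNReal) := by
  rw [uniformMeasure, PMF.toMeasure_uniformOfFintype_apply _ s.toFinite.measurableSet]
  rw [Fintype.card_subtype]

/-! ### Bounds on the length of the queries -/

/-- On every branch, all queries to the random oracle are shorter than `M`. -/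
def Guesser.QueriesShorter {κ : ℕ} {F : Type*} {N : ℕ} (M : ℕ) : Guesser κ F N → Prop
  | .guess _ => True
  | .toss next => ∀ c, (next c).QueriesShorter M
  | .hash x next => x.length < M ∧ ∀ y, (next y).QueriesShorter M
  | .openAt _ next => ∀ a, (next a).QueriesShorter M

/-- On every branch, all queries to the random oracle are shorter than `M`. -/
def Adversary.QueriesShorter {κ : ℕ} {F : Type*} {N : ℕ} (M : ℕ) : Adversary κ F N → Prop
  | .challenge _ _ next => ∀ C, (next C).QueriesShorter M
  | .toss next => ∀ c, (next c).QueriesShorter M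
  | .hash x next => x.length < M ∧ ∀ y, (next y).QueriesShorter M

theorem exists_forall_of_monotone {ι : Type*} [Finite ι] {P : ℕ → ι → Prop}
    (hP : ∀ i, Monotone fun M => P M i) (h : ∀ i, ∃ M, P M i) : ∃ M, ∀ i, P M i := by
  choose f hf using h
  obtain ⟨M, hM⟩ := Finite.bddAbove_range f
  exact ⟨M, fun i => hP i (hM ⟨i, rfl⟩) (hf i)⟩

theorem Guesser.queriesShorter_mono {κ : ℕ} {F : Type*} {N : ℕ} (g : Guesser κ F N) :
    Monotone fun M => g.QueriesShorter M := by
  intro M M' hM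
  induction g with
  | guess b => exact id
  | toss next ih => exact fun h c => ih c (h c)
  | hash x next ih => exact fun h => ⟨h.1.trans_le hM, fun y => ih y (h.2 y)⟩
  | openAt i next ih => exact fun h a => ih a (h a)

theorem Adversary.queriesShorter_mono {κ : ℕ} {F : Type*} {N : ℕ} (A : Adversary κ F N) :
    Monotone fun M => A.QueriesShorter M := by
  intro M M' hM
  induction A with
  | challenge v₀ v₁ next => exact fun h C => (next C).queriesShorter_mono hM (h C)
  | toss next ih => exact fun h c => ih c (h c)
  | hash x next ih => exact fun h => ⟨h.1.trans_le hM, fun y => ih y (h.2 y)⟩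

/-- The strategy tree is well-founded and, `F` being finite, finitely branching, so a common bound
passes from the children to the parent. Strings beyond the bound are available as the points `z`. -/
theorem Guesser.exists_queriesShorter {κ : ℕ} {F : Type*} [Finite F] {N : ℕ} (g : Guesser κ F N) :
    ∃ M, g.QueriesShorter M := by
  induction g with
  | guess b => exact ⟨0, trivial⟩
  | toss next ih => exact exists_forall_of_monotone (fun c => (next c).queriesShorter_mono) ih
  | hash x next ih =>
    obtain ⟨M, hM⟩ := exists_forall_of_monotone (fun c => (next c).queriesShorter_mono) ih
    exact ⟨max M (x.length + 1), lt_of_lt_of_le (Nat.lt_succ_self _) (le_max_right _ _),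
      fun y => (next y).queriesShorter_mono (le_max_left _ _) (hM y)⟩
  | openAt i next ih => exact exists_forall_of_monotone (fun c => (next c).queriesShorter_mono) ih

theorem Adversary.exists_queriesShorter {κ : ℕ} {F : Type*} [Finite F] {N : ℕ}
    (A : Adversary κ F N) : ∃ M, A.QueriesShorter M := by
  induction A with
  | challenge v₀ v₁ next =>
    exact exists_forall_of_monotone (fun c => (next c).queriesShorter_mono)
      fun c => (next c).exists_queriesShorter
  | toss next ih => exact exists_forall_of_monotone (fun c => (next c).queriesShorter_mono) ih
  | hash x next ih =>
    obtain ⟨M, hM⟩ := exists_forall_of_monotone (fun c => (next c).queriesShorter_mono) ih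
    exact ⟨max M (x.length + 1), lt_of_lt_of_le (Nat.lt_succ_self _) (le_max_right _ _),
      fun y => (next y).queriesShorter_mono (le_max_left _ _) (hM y)⟩

/-! ### The ideal game

The ideal game takes the hash of the leaf `i` from the value of the oracle at `z i`, a point that
the adversary does not query, and reveals the salt of a leaf only when the leaf is opened. It ends
with `none` if the adversary queries an input with the salt of a leaf that has not been opened. -/

/-- The hashes of the nodes in the ideal game. -/
def idealHash {κ ℓ : ℕ} {F : Type*} [Zero F] (L : ℕ) (H : Oracle κ) (enc : F → Fin ℓ → Bool)
    (z : Fin L → List Bool) : ℕ → ℕ → Digest κ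
  | 0, j => if h : j < L then H (z ⟨j, h⟩) else H (leafInput L enc j 0 0)
  | n + 1, j =>
      H (labelBits (treeDepth L) (n + 1) j ++
        List.ofFn (idealHash L H enc z n (2 * j)) ++
        List.ofFn (idealHash L H enc z n (2 * j + 1)))

/-- The openings in the ideal game. -/
def idealOpen {κ ℓ : ℕ} {F : Type*} [Zero F] {L : ℕ} (H : Oracle κ) (enc : F → Fin ℓ → Bool)
    (z : Fin L → List Bool) (i : Fin L) : Witness κ L :=
  fun n => idealHash L H enc z n (((i : ℕ) / 2 ^ (n : ℕ)) ^^^ 1)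

/-- The string `x` is an input with the salt of a leaf outside `Q`. -/
def HitsSalt {ℓ N : ℕ} {F : Type*} (enc : F → Fin ℓ → Bool) (r : Fin N → F) (Q : Finset (Fin N))
    (x : List Bool) : Prop :=
  ∃ i, i ∉ Q ∧ ∃ a, x = leafInput N enc i a (r i)

open Classical in
/-- The answer to the query `x` in the ideal game when the leaves in `Q` have been opened. -/
noncomputable def idealAnswer {κ ℓ N : ℕ} {F : Type*} (H : Oracle κ) (enc : F → Fin ℓ → Bool)
    (z : Fin N → List Bool) (v r : Fin N → F) (Q : Finset (Fin N)) (x : List Bool) : Digest κ :=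
  if h : ∃ i, i ∈ Q ∧ leafInput N enc i (v i) (r i) = x then H (z h.choose) else H x

open Classical in
/-- The guess in the ideal game after the commitment has been received, when the leaves in `Q`
have been opened. -/
noncomputable def Guesser.idealRun {κ ℓ N : ℕ} {F : Type*} [Zero F] (H : Oracle κ)
    (enc : F → Fin ℓ → Bool) (T : ℕ) (z : Fin N → List Bool) (v₀ v₁ r : Fin N → F) :
    Guesser κ F N → (coins : ℕ → Bool) → (Q : Finset (Fin N)) → Option Bool
  | .guess b, _, _ => some b
  | .toss next, coins, Q =>
      (next (coins 0)).idealRun H enc T z v₀ v₁ r (fun n => coins (n + 1)) Q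
  | .hash x next, coins, Q =>
      if HitsSalt enc r Q x then none
      else (next (idealAnswer H enc z v₀ r Q x)).idealRun H enc T z v₀ v₁ r coins Q
  | .openAt i next, coins, Q =>
      if v₀ i = v₁ i ∧ i ∉ Q ∧ Q.card < T then
        (next (some (r i, idealOpen H enc z i))).idealRun H enc T z v₀ v₁ r coins (insert i Q)
      else
        (next none).idealRun H enc T z v₀ v₁ r coins Q

open Classical in
/-- The guess in the ideal game. -/
noncomputable def Adversary.idealRun {κ ℓ N : ℕ} {F : Type*} [Zero F] (H : Oracle κ)
    (enc : F → Fin ℓ → Bool) (T : ℕ) (z : Fin N → List Bool) (r : Fin N → F) :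
    Adversary κ F N → (coins : ℕ → Bool) → Option Bool
  | .challenge v₀ v₁ next, coins =>
      (next (idealHash N H enc z (treeDepth N) 0)).idealRun H enc T z v₀ v₁ r coins ∅
  | .toss next, coins => (next (coins 0)).idealRun H enc T z r (fun n => coins (n + 1))
  | .hash x next, coins =>
      if HitsSalt enc r ∅ x then none else (next (H x)).idealRun H enc T z r coins

/-- The vector that is committed to in the game with oracle `H` and challenge bit `b`. -/
def Adversary.committed {κ N : ℕ} {F : Type*} (H : Oracle κ) (b : Bool) :
    Adversary κ F N → (coins : ℕ → Bool) → Fin N → F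
  | .challenge v₀ v₁ _, _ => if b then v₁ else v₀
  | .toss next, coins => (next (coins 0)).committed H b (fun n => coins (n + 1))
  | .hash x next, coins => (next (H x)).committed H b coins

/-! ### Comparison of the real game with the ideal game -/

/-- Reprogramming of the oracle: the inputs at the leaves are exchanged with the points `z`. -/
noncomputable def reprogram {ℓ N : ℕ} {F : Type*} (enc : F → Fin ℓ → Bool)
    (z : Fin N → List Bool) (v r : Fin N → F) : List Bool → List Bool :=
  exchangeFun (fun i : Fin N => leafInput N enc i (v i) (r i)) z

section Reprogram

variable {κ ℓ N M : ℕ} {F : Type*} {enc : F → Fin ℓ → Bool} {z : Fin N → List Bool}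
  (v r : Fin N → F)

theorem leafInput_injective (henc : Function.Injective enc) :
    Function.Injective fun i : Fin N => leafInput N enc i (v i) (r i) := fun _ _ h =>
  Fin.ext (leafInput_inj henc (lt_two_pow_treeDepth _) (lt_two_pow_treeDepth _) h).1

theorem reprogram_involutive (henc : Function.Injective enc) (hz : Function.Injective z)
    (hzM : ∀ i, M ≤ (z i).length) (hM : 2 * treeDepth N + 2 * ℓ < M) :
    Function.Involutive (reprogram enc z v r) := by
  refine exchangeFun_involutive (leafInput_injective v r henc) hz fun i j h => ?_
  have h1 := congrArg List.length h
  simp only [leafInput_length] at h1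
  have := hzM j
  omega

theorem reprogram_leafInput (henc : Function.Injective enc) (i : Fin N) :
    reprogram enc z v r (leafInput N enc i (v i) (r i)) = z i :=
  exchangeFun_left (p := fun i : Fin N => leafInput N enc i (v i) (r i)) z
    (leafInput_injective v r henc) i

theorem reprogram_of_ne {x : List Bool} (hzM : ∀ i, M ≤ (z i).length) (hx : x.length < M)
    (h : ∀ i : Fin N, leafInput N enc i (v i) (r i) ≠ x) : reprogram enc z v r x = x := by
  refine exchangeFun_of_ne h fun i hi => ?_
  have := hzM i
  rw [hi] at this
  omega

/-- The swap moves the salted leaf inputs onto `z` and fixes every other input of the tree: all of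
them are shorter than `M`, padding leaves have an index of at least `N`, and interior labels contain
a star. -/
theorem nodeHash_reprogram [Zero F] (henc : Function.Injective enc) (H : Oracle κ)
    (hzM : ∀ i, M ≤ (z i).length) (hM : 2 * treeDepth N + 2 * ℓ < M)
    (hM' : 2 * treeDepth N + 2 * κ < M) (n j : ℕ) (hn : n ≤ treeDepth N)
    (hj : j < 2 ^ (treeDepth N - n)) :
    nodeHash (H ∘ reprogram enc z v r) enc v r n j = idealHash N H enc z n j := by
  induction n generalizing j with
  | zero =>
    rw [nodeHash, leafHash, idealHash]
    by_cases h : j < N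
    · rw [dif_pos h, ← reprogram_leafInput (z := z) v r henc ⟨j, h⟩]
      simp [padded, h, leafInput]
    · rw [dif_neg h]
      simp only [padded, h, dite_false, Function.comp_apply]
      congr 1
      refine reprogram_of_ne v r hzM ?_ fun i hi => ?_
      · exact (leafInput_length N enc j 0 0).trans_lt hM
      · have := (leafInput_inj henc (lt_two_pow_treeDepth _) hj hi).1
        omega
  | succ n ih =>
    have hp : 2 ^ (treeDepth N - n) = 2 * 2 ^ (treeDepth N - (n + 1)) := by
      rw [← pow_succ']; congr 1; omega
    rw [nodeHash, idealHash, ih (2 * j) (by omega) (by omega), ih (2 * j + 1) (by omega) (by omega),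
      Function.comp_apply]
    congr 1
    refine reprogram_of_ne v r hzM ?_ fun i hi => ?_
    · simp only [List.length_append, labelBits_length hn, List.length_ofFn]
      omega
    · rw [leafInput, List.append_assoc, List.append_assoc] at hi
      obtain ⟨h1, -⟩ := List.append_inj hi (by rw [labelBits_length hn, labelBits_length (by omega)])
      exact labelBits_succ_ne_leaf _ _ _ _ h1.symm

theorem merkleOpen_reprogram [Zero F] (henc : Function.Injective enc) (H : Oracle κ)
    (hzM : ∀ i, M ≤ (z i).length) (hM : 2 * treeDepth N + 2 * ℓ < M)
    (hM' : 2 * treeDepth N + 2 * κ < M) (i : Fin N) :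
    merkleOpen (H ∘ reprogram enc z v r) enc v r i = idealOpen H enc z i := by
  funext n
  refine nodeHash_reprogram v r henc H hzM hM hM' n _ n.2.le ?_
  have hn := n.2
  have h1 : (i : ℕ) / 2 ^ (n : ℕ) < 2 ^ (treeDepth N - n) := by
    rw [Nat.div_lt_iff_lt_mul (by positivity), ← pow_add, Nat.sub_add_cancel hn.le]
    exact lt_two_pow_treeDepth i
  -- Flipping the last bit stays in range because `n` lies strictly below the root, so that `1 < 2 ^
  -- (treeDepth N - n)`.
  exact Nat.xor_lt_two_pow h1 (Nat.one_lt_two_pow (by omega))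

/-- A query moved by the swap is the true input of some leaf, hence contains its salt; if it does
not hit, that leaf is open. There `v` agrees with `v₀`, so the answer can be computed without
knowing the challenge bit. -/
theorem reprogram_of_not_hitsSalt {x : List Bool} (henc : Function.Injective enc) (H : Oracle κ)
    (hzM : ∀ i, M ≤ (z i).length) (hx : x.length < M) {v₀ : Fin N → F} {Q : Finset (Fin N)}
    (hQ : ∀ i ∈ Q, v i = v₀ i) (h : ¬ HitsSalt enc r Q x) :
    H (reprogram enc z v r x) = idealAnswer H enc z v₀ r Q x := by
  unfold idealAnswer
  split_ifs with h'
  · obtain ⟨h1, h2⟩ := h'.choose_spec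
    nth_rewrite 1 [← h2]
    rw [← hQ _ h1, reprogram_leafInput v r henc]
  · rw [reprogram_of_ne v r hzM hx]
    intro i hi
    by_cases hiQ : i ∈ Q
    · exact h' ⟨i, hiQ, by rw [← hQ i hiQ, hi]⟩
    · exact h ⟨i, hiQ, _, hi.symm⟩

theorem Guesser.run_reprogram [Zero F] (henc : Function.Injective enc) (H : Oracle κ)
    (hzM : ∀ i, M ≤ (z i).length) (hM : 2 * treeDepth N + 2 * ℓ < M)
    (hM' : 2 * treeDepth N + 2 * κ < M) (T : ℕ) {v₀ v₁ : Fin N → F} (hv : v = v₀ ∨ v = v₁)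
    (g : Guesser κ F N) (hg : g.QueriesShorter M) (coins : ℕ → Bool) (Q : Finset (Fin N))
    (hQ : ∀ i ∈ Q, v₀ i = v₁ i) (x : Bool) (h : g.idealRun H enc T z v₀ v₁ r coins Q = some x) :
    g.run (H ∘ reprogram enc z v r) enc T v₀ v₁ v r coins Q = x := by
  have hvQ : ∀ i, v₀ i = v₁ i → v i = v₀ i := by
    rintro i hi
    rcases hv with rfl | rfl
    · rfl
    · exact hi.symm
  induction g generalizing coins Q with
  | guess b => simpa [Guesser.idealRun, Guesser.run] using h
  | toss next ih => exact ih _ (hg _) _ _ hQ h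
  | hash y next ih =>
    rw [Guesser.idealRun] at h
    split_ifs at h with hy
    rw [Guesser.run, Function.comp_apply,
      reprogram_of_not_hitsSalt v r henc H hzM hg.1 (fun i hi => hvQ i (hQ i hi)) hy]
    exact ih _ (hg.2 _) _ _ hQ h
  | openAt i next ih =>
    rw [Guesser.idealRun] at h
    rw [Guesser.run]
    split_ifs at h ⊢ with hi
    · rw [merkleOpen_reprogram v r henc H hzM hM hM']
      refine ih _ (hg _) _ _ ?_ h
      intro j hj
      rcases Finset.mem_insert.1 hj with rfl | hj
      · exact hi.1
      · exact hQ j hj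
    · exact ih _ (hg _) _ _ hQ h

/-- The second conclusion is needed because the swap is built from `v`: the reprogrammed oracle must
lead to the same committed vector, so that the event `committed = v` is carried into itself. -/
theorem Adversary.run_reprogram [Zero F] (henc : Function.Injective enc) (H : Oracle κ)
    (hzM : ∀ i, M ≤ (z i).length) (hM : 2 * treeDepth N + 2 * ℓ < M)
    (hM' : 2 * treeDepth N + 2 * κ < M) (T : ℕ) (b : Bool)
    (A : Adversary κ F N) (hA : A.QueriesShorter M) (coins : ℕ → Bool) (x : Bool)
    (h : A.idealRun H enc T z r coins = some x) (hv : A.committed H b coins = v) :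
    A.run (H ∘ reprogram enc z v r) enc T b r coins = x ∧
      A.committed (H ∘ reprogram enc z v r) b coins = v := by
  induction A generalizing coins with
  | challenge v₀ v₁ next =>
    rw [Adversary.committed] at hv
    refine ⟨?_, by rwa [Adversary.committed]⟩
    rw [Adversary.run, hv, merkleCommit, nodeHash_reprogram v r henc H hzM hM hM' _ _ le_rfl
      (by positivity)]
    refine Guesser.run_reprogram v r henc H hzM hM hM' T ?_ _ (hA _) _ _ (by simp) x h
    cases b <;> simp_all
  | toss next ih => exact ih _ (hA _) _ h hv
  | hash y next ih =>
    rw [Adversary.idealRun] at h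
    split_ifs at h with hy
    -- Before the challenge nothing is open, so a query at any true leaf input would already have
    -- aborted the ideal game.
    have hy' : (H ∘ reprogram enc z v r) y = H y := by
      rw [Function.comp_apply, reprogram_of_ne v r hzM hA.1]
      exact fun i hi => hy ⟨i, by simp, _, hi.symm⟩
    rw [Adversary.run, Adversary.committed, hy']
    exact ih _ (hA.2 _) _ h hv

end Reprogram

/-! ### The probability of querying the salt of a leaf that has not been opened -/

section Counting

variable {Ω F : Type*} [Fintype Ω] {N : ℕ}

open Classical in
/-- The elements at which the salts in `Q` are the same as at `ω₀`. -/
noncomputable def agreeSet (r : Ω → Fin N → F) (Q : Finset (Fin N)) (ω₀ : Ω) : Finset Ω :=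
  Finset.univ.filter fun ω => ∀ j ∈ Q, r ω j = r ω₀ j

theorem mem_agreeSet {r : Ω → Fin N → F} {Q : Finset (Fin N)} {ω₀ ω : Ω} :
    ω ∈ agreeSet r Q ω₀ ↔ ∀ j ∈ Q, r ω j = r ω₀ j := by
  simp [agreeSet]

open Classical in
/-- The values of `r` at any `T` positions tell nothing about the value at another position. -/
def SaltsHidden [Fintype F] (T : ℕ) (r : Ω → Fin N → F) : Prop :=
  ∀ (Q : Finset (Fin N)) (ω₀ : Ω) (i : Fin N) (g : F), Q.card ≤ T → i ∉ Q →
    ((agreeSet r Q ω₀).filter fun ω => r ω i = g).card * Fintype.card F ≤ (agreeSet r Q ω₀).card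

open Classical in
-- By unique parsing, `x` can only hit one leaf `i` with one salt value `g`, and that value is taken
-- on at most a fraction `1 / |F|` of the set.
theorem SaltsHidden.card_hitsSalt_le [Fintype F] {T ℓ : ℕ} {r : Ω → Fin N → F}
    (hr : SaltsHidden T r) {enc : F → Fin ℓ → Bool} (henc : Function.Injective enc)
    (Q : Finset (Fin N)) (hQ : Q.card ≤ T) (ω₀ : Ω) (x : List Bool) :
    ((agreeSet r Q ω₀).filter fun ω => HitsSalt enc (r ω) Q x).card * Fintype.card F ≤
      (agreeSet r Q ω₀).card := by
  by_cases h : ∃ i, i ∉ Q ∧ ∃ a g, x = leafInput N enc (i : Fin N) a g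
  · obtain ⟨i, hi, a, g, rfl⟩ := h
    refine le_trans (Nat.mul_le_mul_right _ (Finset.card_le_card ?_)) (hr Q ω₀ i g hQ hi)
    intro ω hω
    rw [Finset.mem_filter] at hω ⊢
    refine ⟨hω.1, ?_⟩
    obtain ⟨j, -, a', h⟩ := hω.2
    obtain ⟨h1, -, h2⟩ := leafInput_inj henc (lt_two_pow_treeDepth _) (lt_two_pow_treeDepth _) h
    rw [Fin.ext h1, h2]
  · rw [Finset.filter_false_of_mem]
    · simp
    · rintro ω - ⟨i, hi, a, hx⟩
      exact h ⟨i, hi, a, _, hx⟩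

open Classical in
-- A union bound over the queries, conditioned on the revealed salts: `agreeSet r Q ω₀` is the set
-- of random choices consistent with what the adversary has seen, for fixed oracle and coins.
theorem SaltsHidden.card_idealRun_eq_none_le [Field F] [Fintype F] {T ℓ κ : ℕ}
    {r : Ω → Fin N → F} (hr : SaltsHidden T r) {enc : F → Fin ℓ → Bool}
    (henc : Function.Injective enc) (H : Oracle κ) (z : Fin N → List Bool) (v₀ v₁ : Fin N → F)
    (g : Guesser κ F N) (q : ℕ) (hg : g.QueriesAtMost q) (coins : ℕ → Bool) (Q : Finset (Fin N))
    (hQ : Q.card ≤ T) (ω₀ : Ω) :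
    ((agreeSet r Q ω₀).filter
        fun ω => g.idealRun H enc T z v₀ v₁ (r ω) coins Q = none).card * Fintype.card F ≤
      q * (agreeSet r Q ω₀).card := by
  induction g generalizing q coins Q ω₀ with
  | guess b => simp [Guesser.idealRun]
  | toss next ih => exact ih _ q (hg _) _ Q hQ ω₀
  | hash x next ih =>
    obtain ⟨hq, hg⟩ := hg
    obtain ⟨q, rfl⟩ : ∃ q', q = q' + 1 := ⟨q - 1, by omega⟩
    have h1 := hr.card_hitsSalt_le henc Q hQ ω₀ x
    have h2 := ih (idealAnswer H enc z v₀ (r ω₀) Q x) q (hg _) coins Q hQ ω₀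
    -- The answer only involves salts in `Q`, so the whole set continues with the same strategy.
    have hans : ∀ ω ∈ agreeSet r Q ω₀,
        idealAnswer H enc z v₀ (r ω) Q x = idealAnswer H enc z v₀ (r ω₀) Q x := by
      intro ω hω
      rw [mem_agreeSet] at hω
      have : (fun i => i ∈ Q ∧ leafInput N enc i (v₀ i) (r ω i) = x) =
          fun i => i ∈ Q ∧ leafInput N enc i (v₀ i) (r ω₀ i) = x := by
        funext i
        by_cases hi : i ∈ Q
        · rw [hω i hi]
        · simp [hi]
      simp only [idealAnswer, this]
    -- An abort happens either at this query (`h1`) or later (`h2`).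
    rw [add_mul, one_mul, add_comm]
    refine le_trans ?_ (add_le_add h1 h2)
    rw [← add_mul]
    refine Nat.mul_le_mul_right _ (le_trans (Finset.card_le_card ?_) (Finset.card_union_le _ _))
    intro ω hω
    rw [Finset.mem_filter, Guesser.idealRun] at hω
    rw [Finset.mem_union, Finset.mem_filter, Finset.mem_filter]
    obtain ⟨hω, h⟩ := hω
    split_ifs at h with hx
    · exact Or.inl ⟨hω, hx⟩
    · exact Or.inr ⟨hω, by rw [← hans ω hω]; exact h⟩
  | openAt i next ih =>
    by_cases hi : v₀ i = v₁ i ∧ i ∉ Q ∧ Q.card < T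
    · have hrun : ∀ ω, (Guesser.openAt i next).idealRun H enc T z v₀ v₁ (r ω) coins Q =
          (next (some (r ω i, idealOpen H enc z i))).idealRun H enc T z v₀ v₁ (r ω) coins
            (insert i Q) := fun ω => by rw [Guesser.idealRun, if_pos hi]
      simp only [hrun]
      -- Opening `i` splits the set by the revealed salt. Each nonempty fibre is the agreement set
      -- of `insert i Q` around one of its points, and the bounds add up.
      rw [Finset.card_eq_sum_card_fiberwise (f := fun ω => r ω i) (t := Finset.univ) (by simp),
        Finset.card_eq_sum_card_fiberwise (s := agreeSet r Q ω₀) (f := fun ω => r ω i)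
          (t := Finset.univ) (by simp), Finset.sum_mul, Finset.mul_sum]
      refine Finset.sum_le_sum fun a _ => ?_
      by_cases hne : ∃ ω₁ ∈ agreeSet r Q ω₀, r ω₁ i = a
      · obtain ⟨ω₁, hω₁, rfl⟩ := hne
        rw [mem_agreeSet] at hω₁
        have hS : (agreeSet r Q ω₀).filter (fun ω => r ω i = r ω₁ i) =
            agreeSet r (insert i Q) ω₁ := by
          ext ω
          simp only [Finset.mem_filter, mem_agreeSet, Finset.forall_mem_insert]
          constructor
          · exact fun h => ⟨h.2, fun j hj => by rw [h.1 j hj, hω₁ j hj]⟩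
          · exact fun h => ⟨fun j hj => by rw [h.2 j hj, hω₁ j hj], h.1⟩
        have h := ih (some (r ω₁ i, idealOpen H enc z i)) q (hg _) coins (insert i Q)
          (by rw [Finset.card_insert_of_notMem hi.2.1]; exact hi.2.2) ω₁
        rw [hS]
        refine le_trans (Nat.mul_le_mul_right _ (Finset.card_le_card ?_)) h
        intro ω hω
        simp only [Finset.mem_filter] at hω ⊢
        rw [← hS, Finset.mem_filter]
        refine ⟨⟨hω.1.1, hω.2⟩, ?_⟩
        rw [← hω.2]
        exact hω.1.2
      · rw [Finset.filter_false_of_mem]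
        · simp
        · intro ω hω h
          exact hne ⟨ω, (Finset.mem_filter.1 hω).1, h⟩
    · have hrun : ∀ ω, (Guesser.openAt i next).idealRun H enc T z v₀ v₁ (r ω) coins Q =
          (next none).idealRun H enc T z v₀ v₁ (r ω) coins Q :=
        fun ω => by rw [Guesser.idealRun, if_neg hi]
      simp only [hrun]
      exact ih _ q (hg _) coins Q hQ ω₀

theorem agreeSet_empty (r : Ω → Fin N → F) (ω₀ : Ω) : agreeSet r ∅ ω₀ = Finset.univ := by
  simp [agreeSet]

open Classical in
theorem SaltsHidden.card_adversary_idealRun_eq_none_le [Field F] [Fintype F] [Nonempty Ω]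
    {T ℓ κ : ℕ} {r : Ω → Fin N → F} (hr : SaltsHidden T r) {enc : F → Fin ℓ → Bool}
    (henc : Function.Injective enc) (H : Oracle κ) (z : Fin N → List Bool)
    (A : Adversary κ F N) (q : ℕ) (hA : A.QueriesAtMost q) (coins : ℕ → Bool) :
    (Finset.univ.filter fun ω => A.idealRun H enc T z (r ω) coins = none).card *
      Fintype.card F ≤ q * Fintype.card Ω := by
  obtain ⟨ω₀⟩ := ‹Nonempty Ω›
  induction A generalizing q coins with
  | challenge v₀ v₁ next =>
    have h := hr.card_idealRun_eq_none_le henc H z v₀ v₁ _ q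
      (hA (idealHash N H enc z (treeDepth N) 0)) coins ∅ (by simp) ω₀
    rwa [agreeSet_empty, Finset.card_univ] at h
  | toss next ih => exact ih _ q (hA _) _
  | hash x next ih =>
    obtain ⟨hq, hA⟩ := hA
    obtain ⟨q, rfl⟩ : ∃ q', q = q' + 1 := ⟨q - 1, by omega⟩
    have h1 := hr.card_hitsSalt_le henc ∅ (by simp) ω₀ x
    rw [agreeSet_empty, Finset.card_univ] at h1
    have h2 := ih (H x) q (hA _) coins
    rw [add_mul, one_mul, add_comm]
    refine le_trans ?_ (add_le_add h1 h2)
    rw [← add_mul]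
    refine Nat.mul_le_mul_right _ (le_trans (Finset.card_le_card ?_) (Finset.card_union_le _ _))
    intro ω hω
    rw [Finset.mem_filter, Adversary.idealRun] at hω
    rw [Finset.mem_union, Finset.mem_filter, Finset.mem_filter]
    obtain ⟨hω, h⟩ := hω
    split_ifs at h with hx
    · exact Or.inl ⟨hω, hx⟩
    · exact Or.inr ⟨hω, h⟩

end Counting

/-! ### The code hides the salts -/

section Code

variable {F : Type*} [Field F] {N K T : ℕ}

theorem heccEncode_add (α : Fin N → F) (m m' : Fin K → F) (s s' : Fin T → F) :
    heccEncode α (m + m') (s + s') = heccEncode α m s + heccEncode α m' s' := by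
  funext i
  simp only [heccEncode, heccPolynomial, Pi.add_apply, map_add, add_mul, Finset.sum_add_distrib,
    Polynomial.eval_add]
  ring

theorem exists_heccPolynomial_eq {P : Polynomial F} (hP : P.natDegree < K + T) :
    ∃ (m : Fin K → F) (s : Fin T → F), heccPolynomial m s = P := by
  refine ⟨fun k => P.coeff k, fun j => P.coeff (K + j), ?_⟩
  conv_rhs => rw [P.as_sum_range_C_mul_X_pow' hP]
  rw [Finset.sum_range_add, heccPolynomial, Finset.sum_range, Finset.sum_range]

/-- A scalar multiple of `∏ j ∈ Q, (X - α j)` vanishes on `Q` but can take any value at `α i`; its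
degree is at most `Q.card < K + T`. -/
theorem exists_heccEncode_eq {α : Fin N → F} (hα : Function.Injective α) {Q : Finset (Fin N)}
    (hQ : Q.card < K + T) {i : Fin N} (hi : i ∉ Q) (a : F) :
    ∃ (m : Fin K → F) (s : Fin T → F),
      (∀ j ∈ Q, heccEncode α m s j = 0) ∧ heccEncode α m s i = a := by
  set P : Polynomial F := ∏ j ∈ Q, (Polynomial.X - Polynomial.C (α j)) with hP
  have hPi : P.eval (α i) ≠ 0 := by
    rw [hP, Polynomial.eval_prod, Finset.prod_ne_zero_iff]
    intro j hj
    rw [Polynomial.eval_sub, Polynomial.eval_X, Polynomial.eval_C, sub_ne_zero]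
    exact fun h => hi (hα h ▸ hj)
  have hPj : ∀ j ∈ Q, P.eval (α j) = 0 := fun j hj => by
    rw [hP, Polynomial.eval_prod, Finset.prod_eq_zero hj (by simp)]
  have hdeg : (Polynomial.C (a / P.eval (α i)) * P).natDegree < K + T := by
    refine (Polynomial.natDegree_C_mul_le _ _).trans_lt ?_
    rw [hP, Polynomial.natDegree_finsetProd_X_sub_C_eq_card]
    exact hQ
  obtain ⟨m, s, h⟩ := exists_heccPolynomial_eq hdeg
  refine ⟨m, s, fun j hj => ?_, ?_⟩
  · rw [heccEncode, h, Polynomial.eval_mul, hPj j hj, mul_zero]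
  · rw [heccEncode, h, Polynomial.eval_mul, Polynomial.eval_C, div_mul_cancel₀ _ hPi]

/-- Adding a codeword that vanishes on `Q` and equals `a - g` at `i` embeds the choices with salt
`g` into those with salt `a`. Summing over the `|F|` values of `a` gives the bound. -/
theorem saltsHidden_heccEncode [Fintype F] {α : Fin N → F} (hα : Function.Injective α)
    (hK : 0 < K) :
    SaltsHidden T fun ω : (Fin K → F) × (Fin T → F) => heccEncode α ω.1 ω.2 := by
  classical
  intro Q ω₀ i g hQ hi
  rw [Finset.card_eq_sum_card_fiberwise (s := agreeSet _ Q ω₀)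
    (f := fun ω : (Fin K → F) × (Fin T → F) => heccEncode α ω.1 ω.2 i) (t := Finset.univ)
    (by simp), mul_comm, ← Finset.card_univ, ← smul_eq_mul, ← Finset.sum_const]
  refine Finset.sum_le_sum fun a _ => ?_
  obtain ⟨m, s, h0, h1⟩ := exists_heccEncode_eq (K := K) (T := T) hα (by omega) hi (a - g)
  refine Finset.card_le_card_of_injOn (fun ω => (ω.1 + m, ω.2 + s)) ?_ ?_
  · intro ω hω
    rw [Finset.mem_coe, Finset.mem_filter, mem_agreeSet] at hω ⊢
    simp only [heccEncode_add, Pi.add_apply, h1] at hω ⊢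
    refine ⟨fun j hj => ?_, by rw [hω.2]; ring⟩
    rw [h0 j hj, add_zero]
    exact hω.1 j hj
  · intro ω _ ω' _ h
    simpa [Prod.ext_iff] using h

end Code

/-! ### Measurability of the games -/

/-- Handles adaptivity: the continuation depends on an observed value, and there are only countably
many of these. -/
theorem Measurable.countable_eval {Ω ι β : Type*} [MeasurableSpace Ω] [MeasurableSpace β]
    [Countable ι] [MeasurableSpace ι] [MeasurableSingletonClass ι] {f : ι → Ω → β}
    (hf : ∀ i, Measurable (f i)) {g : Ω → ι} (hg : Measurable g) :
    Measurable fun ω => f (g ω) ω :=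
  (measurable_from_prod_countable_right (f := fun p : ι × Ω => f p.1 p.2) hf).comp
    (hg.prodMk measurable_id)

instance instMeasurableSpaceOptionBool : MeasurableSpace (Option Bool) := ⊤

theorem measurable_shift : Measurable fun (p : ℕ → Bool) n => p (n + 1) := by fun_prop

section Measurability

variable {κ ℓ N : ℕ} {F : Type*} (enc : F → Fin ℓ → Bool) (T : ℕ)

theorem measurable_oracle_append {α : Type*} [MeasurableSpace α] {h : α → Oracle κ}
    (hh : Measurable h) (l : List Bool) {f g : α → Digest κ}
    (hf : Measurable f) (hg : Measurable g) :
    Measurable fun p => h p (l ++ List.ofFn (f p) ++ List.ofFn (g p)) := by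
  refine Measurable.countable_eval (f := fun d p => h p (l ++ List.ofFn d ++ List.ofFn (g p)))
    (fun d => ?_) hf
  exact Measurable.countable_eval (f := fun d' p => h p (l ++ List.ofFn d ++ List.ofFn d'))
    (fun d' => (measurable_pi_apply _).comp hh) hg

theorem measurable_nodeHash [Zero F] (v r : Fin N → F) (n j : ℕ) :
    Measurable fun H : Oracle κ => nodeHash H enc v r n j := by
  induction n generalizing j with
  | zero => exact measurable_pi_apply _
  | succ n ih => exact measurable_oracle_append measurable_id _ (ih _) (ih _)

theorem measurable_idealHash [Zero F] (z : Fin N → List Bool) (n j : ℕ) :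
    Measurable fun H : Oracle κ => idealHash N H enc z n j := by
  induction n generalizing j with
  | zero =>
    simp only [idealHash]
    split_ifs
    · exact measurable_pi_apply _
    · exact measurable_pi_apply _
  | succ n ih => exact measurable_oracle_append measurable_id _ (ih _) (ih _)

theorem measurable_idealAnswer (z : Fin N → List Bool) (v r : Fin N → F) (Q : Finset (Fin N))
    (x : List Bool) : Measurable fun H : Oracle κ => idealAnswer H enc z v r Q x := by
  unfold idealAnswer
  split_ifs
  · exact measurable_pi_apply _
  · exact measurable_pi_apply _

theorem Guesser.measurable_run [Zero F] (v₀ v₁ v r : Fin N → F) (g : Guesser κ F N)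
    (Q : Finset (Fin N)) :
    Measurable fun p : Oracle κ × (ℕ → Bool) => g.run p.1 enc T v₀ v₁ v r p.2 Q := by
  induction g generalizing Q with
  | guess b => exact measurable_const
  | toss next ih =>
    exact Measurable.countable_eval (g := fun p : Oracle κ × (ℕ → Bool) => p.2 0)
      (f := fun c p => (next c).run p.1 enc T v₀ v₁ v r (fun n => p.2 (n + 1)) Q)
      (fun c => (ih c Q).comp (measurable_fst.prodMk (measurable_shift.comp measurable_snd)))
      ((measurable_pi_apply 0).comp measurable_snd)
  | hash x next ih =>
    exact Measurable.countable_eval (g := fun p : Oracle κ × (ℕ → Bool) => p.1 x)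
      (f := fun y p => (next y).run p.1 enc T v₀ v₁ v r p.2 Q) (fun y => ih y Q)
      ((measurable_pi_apply x).comp measurable_fst)
  | openAt i next ih =>
    simp only [Guesser.run]
    split_ifs
    · refine Measurable.countable_eval
        (g := fun p : Oracle κ × (ℕ → Bool) => merkleOpen p.1 enc v r i)
        (f := fun w p => (next (some (r i, w))).run p.1 enc T v₀ v₁ v r p.2 (insert i Q))
        (fun y => ih _ _) ?_
      exact measurable_pi_lambda _ fun n => (measurable_nodeHash enc v r _ _).comp measurable_fst
    · exact ih _ _

theorem Guesser.measurable_idealRun [Zero F] (z : Fin N → List Bool) (v₀ v₁ r : Fin N → F)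
    (g : Guesser κ F N) (Q : Finset (Fin N)) :
    Measurable fun p : Oracle κ × (ℕ → Bool) => g.idealRun p.1 enc T z v₀ v₁ r p.2 Q := by
  induction g generalizing Q with
  | guess b => exact measurable_const
  | toss next ih =>
    exact Measurable.countable_eval (g := fun p : Oracle κ × (ℕ → Bool) => p.2 0)
      (f := fun c p => (next c).idealRun p.1 enc T z v₀ v₁ r (fun n => p.2 (n + 1)) Q)
      (fun c => (ih c Q).comp (measurable_fst.prodMk (measurable_shift.comp measurable_snd)))
      ((measurable_pi_apply 0).comp measurable_snd)
  | hash x next ih =>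
    simp only [Guesser.idealRun]
    split_ifs
    · exact measurable_const
    · exact Measurable.countable_eval
        (g := fun p : Oracle κ × (ℕ → Bool) => idealAnswer p.1 enc z v₀ r Q x)
        (f := fun y p => (next y).idealRun p.1 enc T z v₀ v₁ r p.2 Q) (fun y => ih y Q)
        ((measurable_idealAnswer enc z v₀ r Q x).comp measurable_fst)
  | openAt i next ih =>
    simp only [Guesser.idealRun]
    split_ifs
    · refine Measurable.countable_eval
        (g := fun p : Oracle κ × (ℕ → Bool) => idealOpen p.1 enc z i)
        (f := fun w p => (next (some (r i, w))).idealRun p.1 enc T z v₀ v₁ r p.2 (insert i Q))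
        (fun y => ih _ _) ?_
      exact measurable_pi_lambda _ fun n => (measurable_idealHash enc z _ _).comp measurable_fst
    · exact ih _ _

theorem Adversary.measurable_run [Zero F] (b : Bool) (r : Fin N → F) (A : Adversary κ F N) :
    Measurable fun p : Oracle κ × (ℕ → Bool) => A.run p.1 enc T b r p.2 := by
  induction A with
  | challenge v₀ v₁ next =>
    exact Measurable.countable_eval
      (g := fun p : Oracle κ × (ℕ → Bool) => merkleCommit p.1 enc (if b then v₁ else v₀) r)
      (f := fun C p => (next C).run p.1 enc T v₀ v₁ (if b then v₁ else v₀) r p.2 ∅)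
      (fun C => (next C).measurable_run enc T _ _ _ r _)
      ((measurable_nodeHash enc _ r _ _).comp measurable_fst)
  | toss next ih =>
    exact Measurable.countable_eval (g := fun p : Oracle κ × (ℕ → Bool) => p.2 0)
      (f := fun c p => (next c).run p.1 enc T b r (fun n => p.2 (n + 1)))
      (fun c => (ih c).comp (measurable_fst.prodMk (measurable_shift.comp measurable_snd)))
      ((measurable_pi_apply 0).comp measurable_snd)
  | hash x next ih =>
    exact Measurable.countable_eval (g := fun p : Oracle κ × (ℕ → Bool) => p.1 x)
      (f := fun y p => (next y).run p.1 enc T b r p.2) ih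
      ((measurable_pi_apply x).comp measurable_fst)

theorem Adversary.measurable_idealRun [Zero F] (z : Fin N → List Bool) (r : Fin N → F)
    (A : Adversary κ F N) :
    Measurable fun p : Oracle κ × (ℕ → Bool) => A.idealRun p.1 enc T z r p.2 := by
  induction A with
  | challenge v₀ v₁ next =>
    exact Measurable.countable_eval
      (g := fun p : Oracle κ × (ℕ → Bool) => idealHash N p.1 enc z (treeDepth N) 0)
      (f := fun C p => (next C).idealRun p.1 enc T z v₀ v₁ r p.2 ∅)
      (fun C => (next C).measurable_idealRun enc T z _ _ r _)
      ((measurable_idealHash enc z _ _).comp measurable_fst)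
  | toss next ih =>
    exact Measurable.countable_eval (g := fun p : Oracle κ × (ℕ → Bool) => p.2 0)
      (f := fun c p => (next c).idealRun p.1 enc T z r (fun n => p.2 (n + 1)))
      (fun c => (ih c).comp (measurable_fst.prodMk (measurable_shift.comp measurable_snd)))
      ((measurable_pi_apply 0).comp measurable_snd)
  | hash x next ih =>
    simp only [Adversary.idealRun]
    split_ifs
    · exact measurable_const
    · exact Measurable.countable_eval (g := fun p : Oracle κ × (ℕ → Bool) => p.1 x)
        (f := fun y p => (next y).idealRun p.1 enc T z r p.2) ih
        ((measurable_pi_apply x).comp measurable_fst)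

theorem Adversary.measurable_committed [MeasurableSpace F] (b : Bool) (A : Adversary κ F N)
    (coins : ℕ → Bool) : Measurable fun H : Oracle κ => A.committed H b coins := by
  induction A generalizing coins with
  | challenge v₀ v₁ next => exact measurable_const
  | toss next ih => exact ih _ _
  | hash x next ih =>
    exact Measurable.countable_eval (g := fun H : Oracle κ => H x)
      (f := fun y H => (next y).committed H b coins) (fun y => ih y coins) (measurable_pi_apply x)

end Measurability

/-! ### The success probability -/

/-- The swap depends on the committed vector, hence on the oracle, and so is not a single
measure-preserving map. It is one on each piece where that vector is fixed. -/
theorem randomOracle_idealRun_le_run {κ ℓ N M : ℕ} {F : Type*} [Zero F] [Finite F]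
    {enc : F → Fin ℓ → Bool} (henc : Function.Injective enc) {z : Fin N → List Bool}
    (hz : Function.Injective z) (hzM : ∀ i, M ≤ (z i).length)
    (hM : 2 * treeDepth N + 2 * ℓ < M) (hM' : 2 * treeDepth N + 2 * κ < M) (T : ℕ) (b : Bool)
    (r : Fin N → F) {A : Adversary κ F N} (hA : A.QueriesShorter M) (coins : ℕ → Bool)
    (x : Bool) :
    randomOracle κ {H | A.idealRun H enc T z r coins = some x} ≤
      randomOracle κ {H | A.run H enc T b r coins = x} := by
  let _ : MeasurableSpace F := ⊤
  have := Fintype.ofFinite (Fin N → F)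
  have hc : ∀ v, MeasurableSet {H : Oracle κ | A.committed H b coins = v} := fun v =>
    A.measurable_committed b coins (measurableSet_singleton v)
  have hrun : MeasurableSet {H : Oracle κ | A.run H enc T b r coins = x} :=
    ((A.measurable_run enc T b r).comp measurable_prodMk_right) (measurableSet_singleton x)
  calc randomOracle κ {H | A.idealRun H enc T z r coins = some x}
      ≤ ∑ v, randomOracle κ ({H | A.idealRun H enc T z r coins = some x} ∩
          {H | A.committed H b coins = v}) := by
        refine le_trans (measure_mono ?_) (measure_iUnion_fintype_le _ _)
        intro H hH
        exact Set.mem_iUnion.2 ⟨A.committed H b coins, hH, rfl⟩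
    _ ≤ ∑ v, randomOracle κ ({H | A.run H enc T b r coins = x} ∩
          {H | A.committed H b coins = v}) := by
        refine Finset.sum_le_sum fun v _ => ?_
        -- For fixed `v`, the real event is replaced by its preimage under the swap, which contains
        -- the ideal event.
        rw [← (measurePreserving_randomOracle_comp κ
          (reprogram_involutive v r henc hz hzM hM)).measure_preimage
          (hrun.inter (hc v)).nullMeasurableSet]
        refine measure_mono ?_
        rintro H ⟨h1, h2⟩
        exact Adversary.run_reprogram v r henc H hzM hM hM' T b A hA coins x h1 h2
    _ = randomOracle κ (⋃ v, {H | A.run H enc T b r coins = x} ∩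
          {H | A.committed H b coins = v}) := by
        rw [measure_iUnion _ fun v => hrun.inter (hc v), tsum_fintype]
        intro v v' hvv'
        refine Set.disjoint_left.2 ?_
        rintro H ⟨-, h⟩ ⟨-, h'⟩
        exact hvv' (h.symm.trans h')
    _ ≤ randomOracle κ {H | A.run H enc T b r coins = x} :=
        measure_mono (Set.iUnion_subset fun v => Set.inter_subset_left)

theorem uniformMeasure_singleton {α : Type*} [Fintype α] [Nonempty α] [MeasurableSpace α]
    [MeasurableSingletonClass α] (a : α) : uniformMeasure α {a} = (Fintype.card α : ENNReal)⁻¹ := by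
  rw [uniformMeasure, PMF.toMeasure_apply_singleton _ _ (measurableSet_singleton a),
    PMF.uniformOfFintype_apply]

theorem uniformMeasure_prod (α β : Type*) [Fintype α] [Nonempty α] [MeasurableSpace α]
    [MeasurableSingletonClass α] [Fintype β] [Nonempty β] [MeasurableSpace β]
    [MeasurableSingletonClass β] :
    (uniformMeasure α).prod (uniformMeasure β) = uniformMeasure (α × β) := by
  refine Measure.ext_of_singleton fun p => ?_
  rw [← Prod.mk.eta (p := p), ← Set.singleton_prod_singleton, Measure.prod_prod,
    Set.singleton_prod_singleton]
  simp only [uniformMeasure_singleton, Fintype.card_prod, Nat.cast_mul]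
  rw [ENNReal.mul_inv (by simp) (by simp)]

/-- `f` does not see the bit: each `ω` without abort is matched by the one bit `x.symm` of its
guess. Hence half of the non-abort probability remains. -/
theorem le_uniformMeasure_eq_some {Ω : Type*} [Fintype Ω] [Nonempty Ω] [MeasurableSpace Ω]
    [MeasurableSingletonClass Ω] (f : Ω → Option Bool) (x : Equiv.Perm Bool)
    {q n : ℕ} (hn : 0 < n)
    (h : (Finset.univ.filter fun ω => f ω = none).card * n ≤ q * Fintype.card Ω) :
    ENNReal.ofReal (1 / 2 * (1 - q / n)) ≤
      uniformMeasure (Bool × Ω) {w | f w.2 = some (x w.1)} := by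
  classical
  have h1 : (Finset.univ.filter fun ω => f ω ≠ none).card ≤
      (Finset.univ.filter fun w : Bool × Ω => f w.2 = some (x w.1)).card := by
    refine Finset.card_le_card_of_injOn (fun ω => (x.symm ((f ω).getD false), ω)) ?_ ?_
    · intro ω hω
      obtain ⟨b, hb⟩ := Option.ne_none_iff_exists'.1 (Finset.mem_filter.1 hω).2
      simp [hb]
    · intro ω _ ω' _ h
      exact (Prod.ext_iff.1 h).2
  have h2 := Finset.card_filter_add_card_filter_not (s := (Finset.univ : Finset Ω))
    (fun ω => f ω = none)
  rw [Finset.card_univ] at h2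
  rw [uniformMeasure_apply]
  simp only [Set.mem_ofPred_eq, Fintype.card_prod, Fintype.card_bool]
  rw [← ENNReal.ofReal_natCast, ← ENNReal.ofReal_natCast, ← ENNReal.ofReal_div_of_pos
    (by have := Fintype.card_pos (α := Ω); positivity)]
  refine ENNReal.ofReal_le_ofReal ?_
  have hΩ : (0 : ℝ) < Fintype.card Ω := by exact_mod_cast Fintype.card_pos
  have hn' : (0 : ℝ) < n := by exact_mod_cast hn
  generalize (Finset.univ.filter fun ω => f ω = none).card = a at *
  generalize (Finset.univ.filter fun ω => ¬ f ω = none).card = a' at *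
  generalize (Finset.univ.filter fun w : Bool × Ω => f w.2 = some (x w.1)).card = a'' at *
  have h' : (a : ℝ) * n ≤ q * Fintype.card Ω := by exact_mod_cast h
  have h1' : (a' : ℝ) ≤ a'' := by exact_mod_cast h1
  have h2' : (a : ℝ) + a' = Fintype.card Ω := by exact_mod_cast h2
  have h3 : (a : ℝ) / Fintype.card Ω ≤ q / n := by rwa [div_le_div_iff₀ hΩ hn']
  have h4 : (a : ℝ) / Fintype.card Ω + a' / Fintype.card Ω = 1 := by
    rw [← add_div, h2', div_self hΩ.ne']
  have h5 : (a' : ℝ) / Fintype.card Ω ≤ a'' / Fintype.card Ω := by gcongr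
  push_cast
  rw [mul_comm (2 : ℝ), ← div_div]
  linarith

theorem le_measure_prod {α β : Type*} [MeasurableSpace α] [MeasurableSpace β] {μ : Measure α}
    [IsProbabilityMeasure μ] {ν : Measure β} [SFinite ν] {s : Set (α × β)} (hs : MeasurableSet s)
    {c : ENNReal} (h : ∀ x, c ≤ ν (Prod.mk x ⁻¹' s)) : c ≤ μ.prod ν s := by
  rw [Measure.prod_apply hs]
  calc c = ∫⁻ _, c ∂μ := by simp
    _ ≤ _ := lintegral_mono h

section Success

variable {κ ℓ N K T q : ℕ} {F : Type*}

/-- The law of the oracle, the coins, the challenge bit, the message and the randomness. -/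
noncomputable def gameMeasure (κ : ℕ) (F : Type*) [Fintype F] [Nonempty F] [MeasurableSpace F]
    (K T : ℕ) : Measure (Oracle κ × (ℕ → Bool) × Bool × (Fin K → F) × (Fin T → F)) :=
  (randomOracle κ).prod (coinTosses.prod ((uniformMeasure Bool).prod
    ((uniformMeasure (Fin K → F)).prod (uniformMeasure (Fin T → F)))))

instance [Fintype F] [Nonempty F] [MeasurableSpace F] : IsProbabilityMeasure (gameMeasure κ F K T) := by
  unfold gameMeasure; infer_instance

/-- The bit, the message and the randomness range over a finite set, so it suffices to decompose by
their values. -/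
theorem measurableSet_game [Finite F] [MeasurableSpace F] [MeasurableSingletonClass F] {β : Type*}
    [MeasurableSpace β] [MeasurableSingletonClass β]
    {f : Oracle κ → (ℕ → Bool) → Bool → (Fin K → F) → (Fin T → F) → β}
    (hf : ∀ b m s, Measurable fun p : Oracle κ × (ℕ → Bool) => f p.1 p.2 b m s) (x : Bool → β) :
    MeasurableSet {ω : Oracle κ × (ℕ → Bool) × Bool × (Fin K → F) × (Fin T → F) |
      f ω.1 ω.2.1 ω.2.2.1 ω.2.2.2.1 ω.2.2.2.2 = x ω.2.2.1} := by
  have h : {ω : Oracle κ × (ℕ → Bool) × Bool × (Fin K → F) × (Fin T → F) |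
      f ω.1 ω.2.1 ω.2.2.1 ω.2.2.2.1 ω.2.2.2.2 = x ω.2.2.1} =
      ⋃ w : Bool × (Fin K → F) × (Fin T → F),
        (fun ω => (ω.1, ω.2.1)) ⁻¹' {p | f p.1 p.2 w.1 w.2.1 w.2.2 = x w.1} ∩
          (fun ω => ω.2.2) ⁻¹' {w} := by
    ext ω
    simp only [Set.mem_ofPred_eq, Set.mem_iUnion, Set.mem_inter_iff, Set.mem_preimage,
      Set.mem_singleton_iff]
    constructor
    · exact fun h => ⟨ω.2.2, h, rfl⟩
    · rintro ⟨w, h, rfl⟩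
      exact h
  rw [h]
  refine MeasurableSet.iUnion fun w => MeasurableSet.inter ?_ ?_
  · have h1 : MeasurableSet {p : Oracle κ × (ℕ → Bool) | f p.1 p.2 w.1 w.2.1 w.2.2 = x w.1} :=
      hf w.1 w.2.1 w.2.2 (measurableSet_singleton _)
    exact (by fun_prop : Measurable fun ω : Oracle κ × (ℕ → Bool) × Bool ×
      (Fin K → F) × (Fin T → F) => (ω.1, ω.2.1)) h1
  · exact (by fun_prop : Measurable fun ω : Oracle κ × (ℕ → Bool) × Bool ×
      (Fin K → F) × (Fin T → F) => ω.2.2) (measurableSet_singleton w)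

variable [Field F] [Fintype F] {α : Fin N → F} {enc : F → Fin ℓ → Bool} {A : Adversary κ F N}

/-- The permutation `x` covers both a correct guess (identity) and a wrong one (negation). -/
theorem le_gameMeasure_run_eq [MeasurableSpace F] [MeasurableSingletonClass F] (hK : 0 < K)
    (hα : Function.Injective α) (henc : Function.Injective enc) (hA : A.QueriesAtMost q)
    (x : Equiv.Perm Bool) :
    ENNReal.ofReal (1 / 2 * (1 - q / Fintype.card F)) ≤ gameMeasure κ F K T
      {ω | A.run ω.1 enc T ω.2.2.1 (heccEncode α ω.2.2.2.1 ω.2.2.2.2) ω.2.1 = x ω.2.2.1} := by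
  classical
  obtain ⟨M₀, hM₀⟩ := A.exists_queriesShorter
  obtain ⟨M, hM, hM', hMA⟩ : ∃ M, 2 * treeDepth N + 2 * ℓ < M ∧ 2 * treeDepth N + 2 * κ < M ∧
      A.QueriesShorter M :=
    ⟨M₀ + 2 * treeDepth N + 2 * ℓ + 2 * κ + 1, by omega, by omega,
      A.queriesShorter_mono (by omega) hM₀⟩
  -- Pairwise different lengths, all at least `M`.
  set z : Fin N → List Bool := fun i => List.replicate (M + i) false with hz_def
  have hz : Function.Injective z := fun i j h => by
    have := congrArg List.length h
    simp only [hz_def, List.length_replicate] at this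
    omega
  have hzM : ∀ i, M ≤ (z i).length := fun i => by simp [hz_def]
  have hideal := measurableSet_game (K := K) (T := T) (F := F)
    (f := fun H c _ m s => A.idealRun H enc T z (heccEncode α m s) c)
    (fun _ m s => A.measurable_idealRun enc T z (heccEncode α m s)) (fun b => some (x b))
  have hreal := measurableSet_game (K := K) (T := T) (F := F)
    (f := fun H c b m s => A.run H enc T b (heccEncode α m s) c)
    (fun b m s => A.measurable_run enc T b (heccEncode α m s)) x
  calc ENNReal.ofReal (1 / 2 * (1 - q / Fintype.card F))
      ≤ gameMeasure κ F K T {ω | A.idealRun ω.1 enc T z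
          (heccEncode α ω.2.2.2.1 ω.2.2.2.2) ω.2.1 = some (x ω.2.2.1)} := by
        -- The ideal game is estimated with oracle and coins fixed, by counting bits and salts; the
        -- comparison below instead fixes everything but the oracle.
        refine le_measure_prod hideal fun H => ?_
        refine le_measure_prod (measurable_prodMk_left hideal) fun c => ?_
        rw [uniformMeasure_prod, uniformMeasure_prod]
        exact le_uniformMeasure_eq_some
          (fun w : (Fin K → F) × (Fin T → F) => A.idealRun H enc T z (heccEncode α w.1 w.2) c) x
          Fintype.card_pos ((saltsHidden_heccEncode hα hK).card_adversary_idealRun_eq_none_le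
            henc H z A q hA c)
    _ ≤ gameMeasure κ F K T {ω | A.run ω.1 enc T ω.2.2.1
          (heccEncode α ω.2.2.2.1 ω.2.2.2.2) ω.2.1 = x ω.2.2.1} := by
        rw [gameMeasure, Measure.prod_apply_symm hideal, Measure.prod_apply_symm hreal]
        exact lintegral_mono fun y =>
          randomOracle_idealRun_le_run henc hz hzM hM hM' T y.2.1
            (heccEncode α y.2.2.1 y.2.2.2) hMA y.1 (x y.2.1)

theorem abs_successProbability_sub_half_le (hK : 0 < K) (hα : Function.Injective α)
    (henc : Function.Injective enc) (hA : A.QueriesAtMost q) :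
    |successProbability K T α enc A - 1 / 2| ≤ q / (2 * Fintype.card F) := by
  let _ : MeasurableSpace F := ⊤
  have hreal := measurableSet_game (K := K) (T := T) (F := F)
    (f := fun H c b m s => A.run H enc T b (heccEncode α m s) c)
    (fun b m s => A.measurable_run enc T b (heccEncode α m s)) id
  have h1 := le_gameMeasure_run_eq (T := T) hK hα henc hA (Equiv.refl Bool)
  have h2 := le_gameMeasure_run_eq (T := T) hK hα henc hA Equiv.boolNot
  rw [ENNReal.ofReal_le_iff_le_toReal (measure_ne_top _ _), ← Measure.real] at h1 h2
  have h3 := probReal_compl_eq_one_sub (μ := gameMeasure κ F K T) hreal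
  -- A wrong guess is the complement of a correct one, so its lower bound is an upper bound for
  -- success.
  have h4 : {ω : Oracle κ × (ℕ → Bool) × Bool × (Fin K → F) × (Fin T → F) |
      A.run ω.1 enc T ω.2.2.1 (heccEncode α ω.2.2.2.1 ω.2.2.2.2) ω.2.1 =
        Equiv.boolNot ω.2.2.1} =
      {ω | A.run ω.1 enc T ω.2.2.1 (heccEncode α ω.2.2.2.1 ω.2.2.2.2) ω.2.1 = id ω.2.2.1}ᶜ := by
    ext ω
    simp only [Set.mem_ofPred_eq, Set.mem_compl_iff, id, Equiv.boolNot_apply]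
    exact Bool.eq_not
  rw [h4, h3] at h2
  have h5 : successProbability K T α enc A = (gameMeasure κ F K T).real
      {ω | A.run ω.1 enc T ω.2.2.1 (heccEncode α ω.2.2.2.1 ω.2.2.2.2) ω.2.1 = id ω.2.2.1} := rfl
  rw [← h5] at h2
  replace h1 : 1 / 2 * (1 - (q : ℝ) / Fintype.card F) ≤ successProbability K T α enc A := h1
  have h6 : (q : ℝ) / (2 * Fintype.card F) = 1 / 2 * (q / Fintype.card F) := by
    rw [mul_comm (2 : ℝ), ← div_div]; ring
  rw [h6, abs_le]
  constructor <;> linarith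

end Success

/-! ### Negligibility of the bound -/

theorem tendsto_polynomial_eval_div_two_pow (p : Polynomial ℕ) :
    Filter.Tendsto (fun n : ℕ => ((p.eval n : ℕ) : ℝ) / 2 ^ n) Filter.atTop (nhds 0) := by
  induction p using Polynomial.induction_on' with
  | add p q hp hq => simpa [add_div] using hp.add hq
  | monomial k a =>
    have h := (tendsto_pow_const_div_const_pow_of_one_lt k (one_lt_two (α := ℝ))).const_mul (a : ℝ)
    simpa [Polynomial.eval_monomial, mul_div_assoc] using h

theorem negligible_polynomial_div_two_pow (p : Polynomial ℕ) :
    Negligible fun n => ((p.eval n : ℕ) : ℝ) / 2 ^ n := by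
  intro c _
  obtain ⟨k, hk⟩ := exists_nat_ge c
  -- The factor `n ^ c` is absorbed into the polynomial as `X ^ k` with `c ≤ k`; comparing the
  -- powers requires `n ≥ 1`.
  have h := tendsto_polynomial_eval_div_two_pow (p * Polynomial.X ^ k)
  obtain ⟨n₀, hn₀⟩ := Filter.eventually_atTop.1
    ((h.eventually_lt_const one_pos).and (Filter.eventually_ge_atTop 1))
  refine ⟨n₀, fun n hn => ?_⟩
  obtain ⟨h1, h2⟩ := hn₀ n hn
  have h2' : (1 : ℝ) ≤ n := by exact_mod_cast h2
  rw [lt_div_iff₀ (by positivity)]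
  refine lt_of_le_of_lt ?_ h1
  rw [Polynomial.eval_mul, Polynomial.eval_pow, Polynomial.eval_X, Nat.cast_mul, Nat.cast_pow,
    mul_div_right_comm]
  refine mul_le_mul_of_nonneg_left ?_ (by positivity)
  rw [← Real.rpow_natCast]
  exact Real.rpow_le_rpow_of_exponent_le h2' hk

theorem Negligible.mono {f g : ℕ → ℝ} (hg : Negligible g) (h : ∀ n, f n ≤ g n) : Negligible f :=
  fun c hc => (hg c hc).imp fun _ hn₀ n hn => (h n).trans_lt (hn₀ n hn)

theorem mainTheorem1
    (F : ℕ → Type*) [∀ κ, Field (F κ)] [∀ κ, Fintype (F κ)]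
    (hF : ∀ κ, 2 ^ κ ≤ Fintype.card (F κ))
    (N K T : ℕ → ℕ) (hK : ∀ κ, 0 < K κ) (hT : ∀ κ, 0 < T κ) (hN : ∀ κ, K κ + T κ ≤ N κ)
    (α : ∀ κ, Fin (N κ) → F κ) (hα : ∀ κ, Function.Injective (α κ))
    (ℓ : ℕ → ℕ) (enc : ∀ κ, F κ → Fin (ℓ κ) → Bool) (henc : ∀ κ, Function.Injective (enc κ))
    (A : ∀ κ, Adversary κ (F κ) (N κ))
    (p : Polynomial ℕ) (hA : ∀ κ, (A κ).QueriesAtMost (p.eval κ)) :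
    Negligible fun κ => |successProbability (K κ) (T κ) (α κ) (enc κ) (A κ) - 1 / 2| := by
  refine (negligible_polynomial_div_two_pow p).mono fun κ => ?_
  refine (abs_successProbability_sub_half_le (hK κ) (hα κ) (henc κ) (hA κ)).trans ?_
  have h : (2 : ℝ) ^ κ ≤ Fintype.card (F κ) := by exact_mod_cast hF κ
  have h0 : (0 : ℝ) < 2 ^ κ := by positivity
  gcongr
  linarith
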